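/- Let $d\ge 0$, let $\tau\in\mathbb R^d_{\ge 0}$, and let $[0,\tau]=\prod_j[0,\tau_j]$ and $(a,b]=\prod_j(a_j,b_j]$. A function $F:[0,\tau]\to\mathbb R$ is called cadlag if at every point $x\in[0,\tau]$ the limit of $F(y)$ as $y\to x$ exists within each of the $2^d$ quadrants $\{y\in[0,\tau]: y_j<x_j\ (j\in r),\ y_j\ge x_j\ (j\notin r)\}$, $r\subset\{1,\dots,d\}$, that accumulates at $x$, and $F$ is continuous at $x$ from the quadrant $\{y\ge x\}$. For nonempty $s\subset\{1,\dots,d\}$ let $F_s(u_s)=F(u_s,0_{-s})$ be the section of $F$ in which the coordinates outside $s$ are set to $0$, and let $V(F_s)\in[0,\infty]$ be its Vitali variation on $(0_s,\tau_s]$: the supremum over grids of $(0_s,\tau_s]$ of the sum over the cells of the absolute value of the generalized difference of $F_s$ over the $2^{|s|}$ corners of the cell. The sectional variation norm of $F$ is \[ \|F\|_v^*=|F(0)|+\sum_{\emptyset\ne s\subset\{1,\dots,d\}}V(F_s). \] Let $F,Z$ be cadlag functions on $[0,\tau]$ with $\|F\|_v^*<\infty$ and $\|Z\|_v^*<\infty$.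 Then the following hold. 1. There is a unique finite signed Borel measure $dZ$ on $[0,\tau]$ with $dZ([0,x])=Z(x)$ for all $x\in[0,\tau]$. For every nonempty $s$ there is a unique finite signed Borel measure $dF_s$ on $(0_s,\tau_s]$ that gives each box $(a,b]$ with $0\le a\le b\le\tau_s$ the generalized difference of $F_s$ over the corners of that box, and its total variation is $\int_{(0_s,\tau_s]}|dF_s|=V(F_s)$. 2. With $\bar Z(u)=dZ([u,\tau])$, all integrals below converge absolutely and \[ \int_{[0,\tau]}F(x)\,dZ(x)=F(0)\,\bar Z(0)+\sum_{\emptyset\ne s\subset\{1,\dots,d\}}\int_{(0_s,\tau_s]}\bar Z(u_s,0_{-s})\,dF_s(u_s). \] 3. Consequently, with $\|\bar Z\|_\infty=\sup_{u\in[0,\tau]}|\bar Z(u)|<\infty$, \[ \int_{[0,\tau]}F(x)\,dZ(x)\le\|\bar Z\|_\infty\,\|F\|_v^*. \] -/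

import Mathlib

open MeasureTheory Filter Topology
open scoped ENNReal

noncomputable section

namespace Sectional

variable {ι : Type*} [Fintype ι] [DecidableEq ι]

/-- The part of the cube `[0, τ]` lying in the quadrant at `x` that is approached strictly from
below in the coordinates in `r` and from above (weakly) in the other coordinates. -/
def quadrant (τ x : ι → ℝ) (r : Finset ι) : Set (ι → ℝ) :=
  {y | y ∈ Set.Icc 0 τ ∧ ∀ j, if j ∈ r then y j < x j else x j ≤ y j}

/-- Multivariate cadlag functions on the cube `[0, τ]`: at every point the limit from each of the
quadrants exists, and the function is continuous from the upper right quadrant. Values outside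
the cube are irrelevant. -/
def IsCadlag (τ : ι → ℝ) (F : (ι → ℝ) → ℝ) : Prop :=
  ∀ x ∈ Set.Icc 0 τ,
    (∀ r : Finset ι, ∃ l : ℝ, Tendsto F (𝓝[quadrant τ x r] x) (𝓝 l)) ∧
      ContinuousWithinAt F (quadrant τ x ∅) x

/-- The half-open box `(a, b]`. -/
def box (a b : ι → ℝ) : Set (ι → ℝ) :=
  Set.univ.pi fun j => Set.Ioc (a j) (b j)

/-- The generalized difference of `G` over the `2 ^ |ι|` corners of the box `(a, b]`. -/
def increment (G : (ι → ℝ) → ℝ) (a b : ι → ℝ) : ℝ :=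
  ∑ t : Finset ι, (-1 : ℝ) ^ t.card * G (fun j => if j ∈ t then a j else b j)

/-- The variation of `G` on `(0, τ]` in the sense of Vitali: the supremum, over the grids of
`(0, τ]`, of the sum of the absolute increments of `G` over the cells of the grid. -/
def vitaliVariation (τ : ι → ℝ) (G : (ι → ℝ) → ℝ) : ℝ≥0∞ :=
  ⨆ (n : ℕ) (g : ι → ℕ → ℝ) (_ : ∀ j, Monotone (g j) ∧ ∀ k, g j k ∈ Set.Icc 0 (τ j)),
    ∑ k : ι → Fin n,
      ENNReal.ofReal |increment G (fun j => g j (k j)) (fun j => g j (k j + 1))|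

/-- `μ` is the signed measure on `(0, τ]` generated by `G`: it gives each box `(a, b]` in the cube
the generalized difference of `G`. -/
def IsGeneratedBy (τ : ι → ℝ) (G : (ι → ℝ) → ℝ) (μ : SignedMeasure (ι → ℝ)) : Prop :=
  (∀ a b : ι → ℝ, 0 ≤ a → a ≤ b → b ≤ τ → μ (box a b) = increment G a b) ∧
    ∀ A : Set (ι → ℝ), Disjoint A (box 0 τ) → μ A = 0

open Classical in
/-- The signed measure on `(0, τ]` generated by `G` (zero if there is none). -/
def generatedMeasure (τ : ι → ℝ) (G : (ι → ℝ) → ℝ) : SignedMeasure (ι → ℝ) :=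
  if h : ∃ μ, IsGeneratedBy τ G μ then h.choose else 0

/-- `ν` is the signed measure on the closed cube `[0, τ]` with distribution function `Z`. As for
the cumulative distribution function of a probability law on the cube, `Z` counts as zero below
the cube, so that the lower faces of the cube may carry mass. -/
def HasDistribution (τ : ι → ℝ) (Z : (ι → ℝ) → ℝ) (ν : SignedMeasure (ι → ℝ)) : Prop :=
  (∀ x ∈ Set.Icc 0 τ, ν (Set.Icc 0 x) = Z x) ∧
    ∀ A : Set (ι → ℝ), Disjoint A (Set.Icc 0 τ) → ν A = 0

open Classical in
/-- The signed measure `dZ` on `[0, τ]` (zero if there is none). -/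
def cubeMeasure (τ : ι → ℝ) (Z : (ι → ℝ) → ℝ) : SignedMeasure (ι → ℝ) :=
  if h : ∃ ν, HasDistribution τ Z ν then h.choose else 0

/-- `Z̄(u) = dZ([u, τ])`. -/
def upper (τ : ι → ℝ) (Z : (ι → ℝ) → ℝ) (u : ι → ℝ) : ℝ :=
  cubeMeasure τ Z (Set.Icc u τ)

/-- The supremum norm over the cube `[0, τ]`. -/
def supNorm (τ : ι → ℝ) (f : (ι → ℝ) → ℝ) : ℝ :=
  ⨆ x : Set.Icc (0 : ι → ℝ) τ, |f x|

/-- The point `(u_s, 0_{-s})`. -/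
def zeroExtend (s : Finset ι) (u : s → ℝ) : ι → ℝ :=
  fun j => if h : j ∈ s then u ⟨j, h⟩ else 0

/-- The restriction `τ_s` of `τ` to the coordinates in `s`. -/
def corner (τ : ι → ℝ) (s : Finset ι) : s → ℝ := fun j => τ j

/-- The section `F_s(u_s) = F(u_s, 0_{-s})`. -/
def sect (F : (ι → ℝ) → ℝ) (s : Finset ι) (u : s → ℝ) : ℝ := F (zeroExtend s u)

/-- The signed measure `dF_s` on `(0_s, τ_s]`. -/
def sectMeasure (τ : ι → ℝ) (F : (ι → ℝ) → ℝ) (s : Finset ι) : SignedMeasure (s → ℝ) :=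
  generatedMeasure (corner τ s) (sect F s)

/-- The nonempty sets of coordinates (the empty section is the separate term `F(0)`). -/
def sections (ι : Type*) [Fintype ι] [DecidableEq ι] : Finset (Finset ι) :=
  Finset.univ.filter fun s => s.Nonempty

/-- The sectional variation norm on `[0, τ]`. -/
def sectionalVariationNorm (τ : ι → ℝ) (F : (ι → ℝ) → ℝ) : ℝ≥0∞ :=
  ENNReal.ofReal |F 0| + ∑ s ∈ sections ι, vitaliVariation (corner τ s) (sect F s)

end Sectional

end

/-! Inclusion-exclusion over the faces through the origin writes F(x) as F(0) plus the generalized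
differences of the sections F_s over (0_s, x_s]. Once dF_s exists, this reads F(x) = F(0) + ∑_s ∫
1{0 < u_s ≤ x_s} dF_s(u_s). Integrate against dZ and apply Fubini: for x ≥ 0 the condition u_s ≤ x_s
means (u_s, 0) ≤ x, so the inner integral is Z̄(u_s, 0_{-s}). This is the integration by parts
(`setIntegral_apply_box_corner`, `setIntegral_eq`); the bound then follows from ∫|dF_s| = V(F_s).

The main work is the existence of dF_s (`exists_isGeneratedBy`). The increments of F_s over the
cells of a uniform grid, placed as atoms at the lower corners and split into positive and negative
parts, have total mass at most V(F_s) and live on a compact cube, so they have weak limits P and Q.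
The difference P - Q gives the correct increment to boxes with null faces. All but countably many
diagonal shifts of a box are of this kind, and right-continuity carries the identity to every box.
The mass bound for P + Q gives one half of the variation identity, disjointness of grid cells the
other. Finally dZ is the atom Z(0) at the origin plus the images of the dZ_s on the faces. -/

namespace Sectional

variable {ι : Type*} [Fintype ι] [DecidableEq ι]

/-! ### Generalized differences -/

/-- Encoding grid values in a multilinear form turns a generalized difference into a single
evaluation at a tuple of differences of basis vectors. The cutoff `N` keeps the defining sum finite.
-/
theorem exists_multilinearMap_single (N : ℕ) (H : (ι → ℕ) → ℝ) :
    ∃ Φ : MultilinearMap ℝ (fun _ : ι => ℕ → ℝ) ℝ,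
      ∀ p : ι → ℕ, (∀ j, p j ≤ N) → Φ (fun j => Pi.single (p j) 1) = H p := by
  refine ⟨∑ x ∈ Fintype.piFinset (fun _ : ι => Finset.range (N + 1)), H x •
    (MultilinearMap.mkPiAlgebra ℝ ι ℝ).compLinearMap
      (fun j => (LinearMap.proj (x j) : (ℕ → ℝ) →ₗ[ℝ] ℝ)), fun p hp => ?_⟩
  rw [sum_apply, Finset.sum_eq_single p]
  · simp
  · intro x _ hxp
    obtain ⟨j, hj⟩ := Function.ne_iff.1 hxp
    have : ∏ j, (Pi.single (p j) (1 : ℝ) : ℕ → ℝ) (x j) = 0 :=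
      Finset.prod_eq_zero (Finset.mem_univ j) (Pi.single_eq_of_ne hj _)
    simp [this]
  · intro h
    exact absurd (Fintype.mem_piFinset.2 fun j => Finset.mem_range_succ_iff.2 (hp j)) h

theorem multilinearMap_map_sub_univ {M : Type*} [AddCommGroup M] [Module ℝ M]
    (Φ : MultilinearMap ℝ (fun _ : ι => M) ℝ) (u v : ι → M) :
    Φ (fun j => v j - u j) =
      ∑ t : Finset ι, (-1 : ℝ) ^ t.card * Φ (fun j => if j ∈ t then u j else v j) := by
  have h : (fun j => v j - u j) = (fun j => (-1 : ℝ) • u j) + v := by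
    ext j; simp [sub_eq_neg_add]
  rw [h, Φ.map_add_univ]
  refine Finset.sum_congr rfl fun t _ => ?_
  have := Φ.map_piecewise_smul (fun _ => (-1 : ℝ)) (t.piecewise u v) t
  rw [Finset.prod_const, smul_eq_mul] at this
  convert this using 2
  · ext j
    by_cases hj : j ∈ t <;> simp [hj]
  · rfl

/-- Basis vectors telescope in each coordinate separately, and multilinearity expands the result
into the sum over cells. -/
theorem sum_increment_Ico (G : (ι → ℝ) → ℝ) (g : ι → ℕ → ℝ) (p q : ι → ℕ) (hpq : p ≤ q) :
    ∑ k ∈ Fintype.piFinset (fun j => Finset.Ico (p j) (q j)),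
        increment G (fun j => g j (k j)) (fun j => g j (k j + 1)) =
      increment G (fun j => g j (p j)) (fun j => g j (q j)) := by
  obtain ⟨Φ, hΦ⟩ := exists_multilinearMap_single (∑ j, q j) (fun k => G fun j => g j (k j))
  have hq : ∀ j, q j ≤ ∑ j, q j := fun j =>
    Finset.single_le_sum (f := q) (fun _ _ => Nat.zero_le _) (Finset.mem_univ j)
  have key : ∀ k l : ι → ℕ, (∀ j, k j ≤ ∑ j, q j) → (∀ j, l j ≤ ∑ j, q j) →
      increment G (fun j => g j (k j)) (fun j => g j (l j)) =
        Φ (fun j => Pi.single (l j) 1 - Pi.single (k j) 1) := by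
    intro k l hk hl
    rw [multilinearMap_map_sub_univ, increment]
    refine Finset.sum_congr rfl fun t _ => ?_
    have := hΦ (fun j => if j ∈ t then k j else l j) (fun j => by split_ifs; exacts [hk j, hl j])
    simp only [apply_ite (Pi.single (M := fun _ : ℕ => ℝ) · 1), apply_ite (g _)] at this
    rw [← this]
  rw [key p q (fun j => (hpq j).trans (hq j)) hq]
  have : (fun j => (Pi.single (q j) 1 - Pi.single (p j) 1 : ℕ → ℝ)) =
      fun j => ∑ k ∈ Finset.Ico (p j) (q j), (Pi.single (k + 1) 1 - Pi.single k 1 : ℕ → ℝ) := by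
    ext1 j
    exact (Finset.sum_Ico_sub (fun k => (Pi.single k 1 : ℕ → ℝ)) (hpq j)).symm
  rw [this, MultilinearMap.map_sum_finset]
  refine Finset.sum_congr rfl fun k hk => ?_
  rw [Fintype.mem_piFinset] at hk
  have hk' : ∀ j, k j < q j := fun j => (Finset.mem_Ico.1 (hk j)).2
  exact key k (fun j => k j + 1) (fun j => (hk' j).le.trans (hq j))
    (fun j => (Nat.succ_le_of_lt (hk' j)).trans (hq j))

/-- Möbius inversion over the lattice of finite sets. -/
theorem sum_powerset_neg_one_pow_mul_sdiff (h : Finset ι → ℝ) :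
    ∑ s : Finset ι, ∑ t ∈ s.powerset, (-1 : ℝ) ^ t.card * h (s \ t) = h Finset.univ := by
  -- Reindexing by disjoint pairs `(r, t)` with union `s` allows summing over `t` first: for fixed
  -- `r` the signs over subsets of `rᶜ` cancel unless `rᶜ` is empty.
  have h1 : ∀ s : Finset ι, ∑ t ∈ s.powerset, (-1 : ℝ) ^ t.card * h (s \ t) =
      ∑ r : Finset ι, ∑ t : Finset ι, if Disjoint r t ∧ r ∪ t = s then (-1 : ℝ) ^ t.card * h r
        else 0 := by
    intro s
    rw [Finset.sum_comm, ← Finset.sum_subset (Finset.subset_univ s.powerset)]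
    · refine Finset.sum_congr rfl fun t ht => ?_
      rw [Finset.mem_powerset] at ht
      rw [Finset.sum_eq_single (s \ t)]
      · simp [Finset.sdiff_disjoint, Finset.sdiff_union_of_subset ht]
      · rintro r - hr
        rw [if_neg]
        rintro ⟨hd, rfl⟩
        exact hr (by rw [Finset.union_sdiff_cancel_right hd])
      · simp
    · intro t _ ht
      refine Finset.sum_eq_zero fun r _ => if_neg ?_
      rintro ⟨-, rfl⟩
      exact ht (Finset.mem_powerset.2 Finset.subset_union_right)
  simp_rw [h1]
  rw [Finset.sum_comm, Finset.sum_eq_single Finset.univ]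
  · rw [Finset.sum_comm, Finset.sum_eq_single ∅]
    · simp
    · intro t _ ht
      refine Finset.sum_eq_zero fun s _ => if_neg ?_
      rintro ⟨hd, -⟩
      exact ht (disjoint_top.1 hd.symm)
    · simp
  · intro r _ hr
    rw [Finset.sum_comm]
    have h2 : ∀ t : Finset ι, (∑ s : Finset ι,
        if Disjoint r t ∧ r ∪ t = s then (-1 : ℝ) ^ t.card * h r else 0) =
        if t ∈ rᶜ.powerset then (-1 : ℝ) ^ t.card * h r else 0 := by
      intro t
      by_cases hd : Disjoint r t
      · simp [hd, le_compl_iff_disjoint_right, disjoint_comm]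
      · rw [if_neg]
        · simp [hd]
        · rw [Finset.mem_powerset, le_compl_iff_disjoint_left]
          exact hd
    simp_rw [h2]
    rw [Finset.sum_ite_mem, Finset.univ_inter, ← Finset.sum_mul]
    have h3 : ∑ t ∈ rᶜ.powerset, (-1 : ℝ) ^ t.card = 0 := by
      have := Finset.sum_powerset_neg_one_pow_card (x := rᶜ)
      rw [if_neg (by simpa [Finset.compl_eq_empty_iff] using hr)] at this
      exact_mod_cast this
    rw [h3, zero_mul]
  · simp

omit [Fintype ι] in
theorem increment_sect_zero_corner (F : (ι → ℝ) → ℝ) (x : ι → ℝ) (s : Finset ι) :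
    increment (sect F s) 0 (corner x s) =
      ∑ t ∈ s.powerset, (-1 : ℝ) ^ t.card * F (fun j => if j ∈ s \ t then x j else 0) := by
  rw [increment]
  refine Finset.sum_bij' (fun t _ => t.map (Function.Embedding.subtype _))
    (fun t _ => t.subtype (· ∈ s)) ?_ ?_ ?_ ?_ ?_
  · intro t _
    rw [Finset.mem_powerset]
    intro j hj
    obtain ⟨i, -, rfl⟩ := Finset.mem_map.1 hj
    exact i.2
  · simp
  · intro t _
    ext i
    simp
  · intro t ht
    rw [Finset.mem_powerset] at ht
    exact Finset.subtype_map_of_mem fun i hi => ht hi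
  · intro t _
    rw [Finset.card_map, sect]
    congr 2
    ext j
    by_cases hj : j ∈ s
    · by_cases ht : (⟨j, hj⟩ : s) ∈ t <;> simp [zeroExtend, hj, ht, corner]
    · simp [zeroExtend, hj]

/-- A function is the sum of the generalized differences of its sections. -/
theorem eq_add_sum_increment_sect (F : (ι → ℝ) → ℝ) (x : ι → ℝ) :
    F x = F 0 + ∑ s ∈ sections ι, increment (sect F s) 0 (corner x s) := by
  have h := sum_powerset_neg_one_pow_mul_sdiff (fun r => F fun j => if j ∈ r then x j else 0)
  simp only [← increment_sect_zero_corner, Finset.mem_univ, if_true] at h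
  rw [← h, ← Finset.sum_filter_add_sum_filter_not _ (fun s : Finset ι => s.Nonempty), add_comm]
  congr 1
  have : Finset.univ.filter (fun s : Finset ι => ¬ s.Nonempty) = {∅} := by
    ext s; simp
  rw [this, Finset.sum_singleton, increment_sect_zero_corner]
  simp
  rfl

/-! ### Boxes -/

omit [Fintype ι] [DecidableEq ι] in
theorem mem_box {a b x : ι → ℝ} : x ∈ box a b ↔ ∀ j, a j < x j ∧ x j ≤ b j := by
  simp [box]

omit [DecidableEq ι] in
theorem measurableSet_box (a b : ι → ℝ) : MeasurableSet (box a b) :=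
  MeasurableSet.univ_pi fun _ => measurableSet_Ioc

omit [Fintype ι] [DecidableEq ι] in
theorem box_subset_box {a b c d : ι → ℝ} (hca : c ≤ a) (hbd : b ≤ d) : box a b ⊆ box c d :=
  Set.pi_mono fun j _ => Set.Ioc_subset_Ioc (hca j) (hbd j)

omit [Fintype ι] [DecidableEq ι] in
-- A closure point off all face hyperplanes satisfies strict inequalities, hence is interior.
theorem frontier_box_subset [Finite ι] (a b : ι → ℝ) :
    frontier (box a b) ⊆ ⋃ j, ({x | x j = a j} ∪ {x | x j = b j}) := by
  intro x hx
  by_contra hne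
  simp only [Set.mem_iUnion, Set.mem_union, Set.mem_ofPred_eq, not_exists, not_or] at hne
  have h1 : x ∈ Set.Icc a b := by
    have : box a b ⊆ Set.Icc a b := fun y hy =>
      ⟨fun j => (mem_box.1 hy j).1.le, fun j => (mem_box.1 hy j).2⟩
    exact closure_minimal this isClosed_Icc hx.1
  refine hx.2 (mem_interior.2 ⟨Set.univ.pi fun j => Set.Ioo (a j) (b j),
    Set.pi_mono fun j _ => Set.Ioo_subset_Ioc_self,
    isOpen_set_pi Set.finite_univ fun _ _ => isOpen_Ioo, fun j _ => ?_⟩)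
  exact ⟨lt_of_le_of_ne (h1.1 j) (Ne.symm (hne j).1), lt_of_le_of_ne (h1.2 j) (hne j).2⟩

theorem sum_measure_cells_le (μ : Measure (ι → ℝ)) {τ : ι → ℝ} {n : ℕ} {g : ι → ℕ → ℝ}
    (hg : ∀ j, Monotone (g j) ∧ ∀ k, g j k ∈ Set.Icc 0 (τ j)) :
    ∑ k : ι → Fin n, μ (box (fun j => g j (k j)) (fun j => g j (k j + 1))) ≤ μ (box 0 τ) := by
  have hsub : ∀ k : ι → Fin n, box (fun j => g j (k j)) (fun j => g j (k j + 1)) ⊆ box 0 τ :=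
    fun k => box_subset_box (fun j => ((hg j).2 _).1) (fun j => ((hg j).2 _).2)
  rw [← measure_biUnion_finset _ (fun k _ => measurableSet_box _ _)]
  · exact measure_mono (Set.iUnion₂_subset fun k _ => hsub k)
  · intro k _ l _ hkl
    obtain ⟨j, hj⟩ := Function.ne_iff.1 hkl
    refine Set.disjoint_univ_pi.2 ⟨j, ?_⟩
    exact (hg j).1.pairwise_disjoint_on_Ioc_succ (fun h => hj (Fin.ext h))

/-! ### Uniqueness -/

omit [DecidableEq ι] in
-- Lower orthants form a π-system generating the Borel sets; equality of total masses handles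
-- complements.
theorem signedMeasure_ext_of_Iic {μ ν : SignedMeasure (ι → ℝ)}
    (h : ∀ x, μ (Set.Iic x) = ν (Set.Iic x)) (huniv : μ Set.univ = ν Set.univ) : μ = ν := by
  refine VectorMeasure.ext_of_generateFrom
    (Set.univ.pi '' Set.univ.pi fun _ : ι => Set.range (Set.Iic : ℝ → Set ℝ)) ?_ ?_
    (IsPiSystem.pi fun _ => isPiSystem_Iic) huniv
  · rintro - ⟨S, hS, rfl⟩
    choose! x hx using fun j => hS j (Set.mem_univ j)
    have : Set.univ.pi S = Set.Iic x := by
      rw [← Set.pi_univ_Iic]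
      exact Set.pi_congr rfl fun j _ => (hx j).symm
    rw [this, h]
  · refine (generateFrom_eq_pi (fun _ => ?_) fun _ => ?_).symm
    · rw [← borel_eq_generateFrom_Iic]
      exact (BorelSpace.measurable_eq (α := ℝ)).symm
    · refine ⟨fun n => Set.Iic (n : ℝ), fun n => ⟨n, rfl⟩, Set.eq_univ_of_forall fun x => ?_⟩
      obtain ⟨n, hn⟩ := exists_nat_ge x
      exact Set.mem_iUnion.2 ⟨n, hn⟩

theorem apply_inter_of_support {X : Type*} [MeasurableSpace X] {μ : SignedMeasure X} {S A : Set X}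
    (hS : MeasurableSet S) (hμ : ∀ A, Disjoint A S → μ A = 0) (hA : MeasurableSet A) :
    μ (A ∩ S) = μ A := by
  conv_rhs => rw [← Set.inter_union_sdiff A S]
  rw [VectorMeasure.of_union (Set.disjoint_sdiff_inter.symm) (hA.inter hS) (hA.diff hS),
    hμ (A \ S) Set.disjoint_sdiff_left, add_zero]

/-- Within the support, an orthant cuts out `(0, x ⊓ τ]`, which is either empty or a box whose mass
is prescribed. -/
theorem IsGeneratedBy.unique {τ : ι → ℝ} (hτ : 0 ≤ τ) {G : (ι → ℝ) → ℝ}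
    {μ ν : SignedMeasure (ι → ℝ)} (hμ : IsGeneratedBy τ G μ) (hν : IsGeneratedBy τ G ν) :
    μ = ν := by
  have key : ∀ x, 0 ≤ x → μ (box 0 (x ⊓ τ)) = ν (box 0 (x ⊓ τ)) := fun x hx => by
    rw [hμ.1 _ _ le_rfl (le_inf hx hτ) inf_le_right, hν.1 _ _ le_rfl (le_inf hx hτ) inf_le_right]
  refine signedMeasure_ext_of_Iic (fun x => ?_) ?_
  · rw [← apply_inter_of_support (measurableSet_box 0 τ) hμ.2 measurableSet_Iic,
      ← apply_inter_of_support (measurableSet_box 0 τ) hν.2 measurableSet_Iic]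
    have hI : Set.Iic x ∩ box 0 τ = box 0 (x ⊓ τ) := by
      ext y
      simp only [Set.mem_inter_iff, Set.mem_Iic, mem_box, Pi.le_def, Pi.inf_apply, le_inf_iff]
      exact ⟨fun h j => ⟨(h.2 j).1, h.1 j, (h.2 j).2⟩,
        fun h => ⟨fun j => (h j).2.1, fun j => ⟨(h j).1, (h j).2.2⟩⟩⟩
    rw [hI]
    by_cases hx : 0 ≤ x
    · exact key x hx
    · obtain ⟨j, hj⟩ : ∃ j, x j < 0 := by simpa [Pi.le_def] using hx
      have : box 0 (x ⊓ τ) = ∅ := Set.eq_empty_of_forall_notMem fun y hy => by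
        have := mem_box.1 hy j
        simp only [Pi.zero_apply, Pi.inf_apply, le_inf_iff] at this
        linarith [this.1, this.2.1]
      simp [this]
  · rw [← apply_inter_of_support (measurableSet_box 0 τ) hμ.2 MeasurableSet.univ,
      ← apply_inter_of_support (measurableSet_box 0 τ) hν.2 MeasurableSet.univ, Set.univ_inter]
    simpa using key τ hτ

omit [DecidableEq ι] in
theorem HasDistribution.unique {τ : ι → ℝ} (hτ : 0 ≤ τ) {Z : (ι → ℝ) → ℝ}
    {μ ν : SignedMeasure (ι → ℝ)} (hμ : HasDistribution τ Z μ) (hν : HasDistribution τ Z ν) :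
    μ = ν := by
  refine signedMeasure_ext_of_Iic (fun x => ?_) ?_
  · rw [← apply_inter_of_support measurableSet_Icc hμ.2 measurableSet_Iic,
      ← apply_inter_of_support measurableSet_Icc hν.2 measurableSet_Iic]
    have hI : Set.Iic x ∩ Set.Icc 0 τ = Set.Icc 0 (x ⊓ τ) := by
      ext y
      simp only [Set.mem_inter_iff, Set.mem_Iic, Set.mem_Icc, le_inf_iff]
      tauto
    rw [hI]
    by_cases hx : 0 ≤ x
    · rw [hμ.1 _ ⟨le_inf hx hτ, inf_le_right⟩, hν.1 _ ⟨le_inf hx hτ, inf_le_right⟩]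
    · rw [Set.Icc_eq_empty fun h => hx (h.trans inf_le_left)]
      simp
  · rw [← apply_inter_of_support measurableSet_Icc hμ.2 MeasurableSet.univ,
      ← apply_inter_of_support measurableSet_Icc hν.2 MeasurableSet.univ, Set.univ_inter,
      hμ.1 _ ⟨hτ, le_rfl⟩, hν.1 _ ⟨hτ, le_rfl⟩]

/-- Each absolute increment is |μ(cell)| ≤ |μ|(cell), and the cells of a grid are disjoint. -/
theorem vitaliVariation_le_variation {τ : ι → ℝ} {G : (ι → ℝ) → ℝ} {μ : SignedMeasure (ι → ℝ)}
    (hμ : IsGeneratedBy τ G μ) : vitaliVariation τ G ≤ μ.variation (box 0 τ) := by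
  refine iSup_le fun n => iSup_le fun g => iSup_le fun hg => ?_
  refine le_trans (Finset.sum_le_sum fun k _ => ?_) (sum_measure_cells_le μ.variation (n := n) hg)
  rw [← hμ.1 _ _ (fun j => ((hg j).2 _).1) (fun j => (hg j).1 (Nat.le_succ _))
    (fun j => ((hg j).2 _).2), ← Real.enorm_eq_ofReal_abs]
  exact VectorMeasure.enorm_measure_le_variation _ _

/-! ### Weak limits of finite measures -/

theorem tendsto_apply_of_tendsto_of_null_frontier {Ω κ : Type*} [MeasurableSpace Ω]
    [TopologicalSpace Ω] [HasOuterApproxClosed Ω] [OpensMeasurableSpace Ω] {U : Ultrafilter κ}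
    {μ : FiniteMeasure Ω} {μs : κ → FiniteMeasure Ω} (h : Tendsto μs U (𝓝 μ)) {A : Set Ω}
    (hA : MeasurableSet A) (hfr : (μ : Measure Ω) (frontier A) = 0) :
    Tendsto (fun i => (μs i : Measure Ω) A) U (𝓝 ((μ : Measure Ω) A)) := by
  have key : ∀ B : Set Ω, (μ : Measure Ω) (frontier B) = 0 →
      ∃ l ≤ (μ : Measure Ω) B, Tendsto (fun i => (μs i : Measure Ω) B) U (𝓝 l) := by
    intro B hB
    obtain ⟨l, -, hl⟩ := isCompact_univ.ultrafilter_le_nhds'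
      (U.map fun i => (μs i : Measure Ω) B) univ_mem
    refine ⟨l, ?_, hl⟩
    have hl' : Tendsto (fun i => (μs i : Measure Ω) B) U (𝓝 l) := hl
    calc l = limsup (fun i => (μs i : Measure Ω) B) U := hl'.limsup_eq.symm
      _ ≤ limsup (fun i => (μs i : Measure Ω) (closure B)) U :=
        limsup_le_limsup (Eventually.of_forall fun i => measure_mono subset_closure)
      _ ≤ (μ : Measure Ω) (closure B) :=
        FiniteMeasure.limsup_measure_closed_le_of_tendsto h isClosed_closure
      _ = (μ : Measure Ω) (B ∪ frontier B) := by rw [closure_eq_self_union_frontier]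
      _ ≤ (μ : Measure Ω) B + (μ : Measure Ω) (frontier B) := measure_union_le _ _
      _ = (μ : Measure Ω) B := by rw [hB, add_zero]
  obtain ⟨l, hl, hlt⟩ := key A hfr
  obtain ⟨m, hm, hmt⟩ := key Aᶜ (by rwa [frontier_compl])
  have hsum : Tendsto (fun i => (μs i : Measure Ω) Set.univ) U (𝓝 ((μ : Measure Ω) Set.univ)) := by
    have := ENNReal.tendsto_coe.2 ((FiniteMeasure.continuous_mass.tendsto μ).comp h)
    simpa using this
  have heq : l + m = (μ : Measure Ω) A + (μ : Measure Ω) Aᶜ := by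
    rw [measure_add_measure_compl hA]
    refine tendsto_nhds_unique (hlt.add hmt) (hsum.congr fun i => ?_)
    rw [measure_add_measure_compl hA]
  have : l = (μ : Measure Ω) A := by
    refine le_antisymm hl ?_
    have h1 : (μ : Measure Ω) A + (μ : Measure Ω) Aᶜ ≤ l + (μ : Measure Ω) Aᶜ :=
      heq ▸ add_le_add le_rfl hm
    exact (ENNReal.add_le_add_iff_right (measure_ne_top _ _)).1 h1
  rwa [← this]

/-! ### Measures carried by a grid -/

/-- The positive part of the signed measure with mass `w k` at the grid point `(g j (k j))_j`. -/
noncomputable def gridMeasure (N : ℕ) (g : ι → ℕ → ℝ) (w : (ι → ℕ) → ℝ) : Measure (ι → ℝ) :=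
  ∑ k ∈ Fintype.piFinset (fun _ : ι => Finset.range N),
    ENNReal.ofReal (w k) • Measure.dirac (fun j => g j (k j))

theorem gridMeasure_apply (N : ℕ) (g : ι → ℕ → ℝ) (w : (ι → ℕ) → ℝ) {A : Set (ι → ℝ)}
    (hA : MeasurableSet A) :
    gridMeasure N g w A = ∑ k ∈ Fintype.piFinset (fun _ : ι => Finset.range N),
      ENNReal.ofReal (w k) * A.indicator 1 (fun j => g j (k j)) := by
  simp [gridMeasure, Measure.finsetSum_apply, Measure.dirac_apply' _ hA]

instance (N : ℕ) (g : ι → ℕ → ℝ) (w : (ι → ℕ) → ℝ) : IsFiniteMeasure (gridMeasure N g w) := by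
  refine ⟨?_⟩
  rw [gridMeasure_apply N g w MeasurableSet.univ]
  simp [ENNReal.sum_lt_top]

/-- The weights `-w` produce the negative part, and w⁺ - w⁻ = w. -/
theorem gridMeasure_real_sub (N : ℕ) (g : ι → ℕ → ℝ) (w : (ι → ℕ) → ℝ) {A : Set (ι → ℝ)}
    (hA : MeasurableSet A) :
    (gridMeasure N g w).real A - (gridMeasure N g (-w)).real A =
      ∑ k ∈ Fintype.piFinset (fun _ : ι => Finset.range N),
        A.indicator (fun _ => w k) (fun j => g j (k j)) := by
  have h : ∀ (v : (ι → ℕ) → ℝ), (gridMeasure N g v).real A =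
      ∑ k ∈ Fintype.piFinset (fun _ : ι => Finset.range N),
        A.indicator (fun _ => max (v k) 0) (fun j => g j (k j)) := by
    intro v
    rw [Measure.real, gridMeasure_apply N g v hA, ENNReal.toReal_sum]
    · refine Finset.sum_congr rfl fun k _ => ?_
      by_cases hk : (fun j => g j (k j)) ∈ A <;> simp [hk, ENNReal.toReal_ofReal']
    · intro k _
      by_cases hk : (fun j => g j (k j)) ∈ A <;> simp [hk]
  rw [h, h, ← Finset.sum_sub_distrib]
  refine Finset.sum_congr rfl fun k _ => ?_
  by_cases hk : (fun j => g j (k j)) ∈ A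
  · simp only [hk, Set.indicator_of_mem, Pi.neg_apply]
    exact max_zero_sub_max_neg_zero_eq_self (w k)
  · simp [hk]

theorem sum_fin_eq_sum_piFinset_range {M : Type*} [AddCommMonoid M] (n : ℕ) (f : (ι → ℕ) → M) :
    ∑ k : ι → Fin n, f (fun j => k j) =
      ∑ k ∈ Fintype.piFinset (fun _ : ι => Finset.range n), f k := by
  refine Finset.sum_bij (fun k _ j => (k j : ℕ)) ?_ ?_ ?_ ?_
  · intro k _
    exact Fintype.mem_piFinset.2 fun j => Finset.mem_range.2 (k j).2
  · intro k _ l _ h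
    exact funext fun j => Fin.ext (congrFun h j)
  · intro k hk
    exact ⟨fun j => ⟨k j, Finset.mem_range.1 (Fintype.mem_piFinset.1 hk j)⟩,
      Finset.mem_univ _, rfl⟩
  · intro k _
    rfl

/-- Since w⁺ + w⁻ = |w|, the total mass is one of the sums in the supremum defining the Vitali
variation. -/
theorem gridMeasure_mass_add_le (τ : ι → ℝ) (G : (ι → ℝ) → ℝ) (n : ℕ) (g : ι → ℕ → ℝ)
    (hg : ∀ j, Monotone (g j) ∧ ∀ k, g j k ∈ Set.Icc 0 (τ j)) (w : (ι → ℕ) → ℝ)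
    (hw : ∀ k, w k = increment G (fun j => g j (k j)) (fun j => g j (k j + 1))) :
    gridMeasure n g w Set.univ + gridMeasure n g (-w) Set.univ ≤ vitaliVariation τ G := by
  rw [gridMeasure_apply n g _ MeasurableSet.univ, gridMeasure_apply n g _ MeasurableSet.univ,
    ← Finset.sum_add_distrib]
  refine le_trans (le_of_eq ?_) (le_iSup_of_le n (le_iSup_of_le g (le_iSup_of_le hg le_rfl)))
  rw [sum_fin_eq_sum_piFinset_range n fun k =>
    ENNReal.ofReal |increment G (fun j => g j (k j)) (fun j => g j (k j + 1))|]
  refine Finset.sum_congr rfl fun k _ => ?_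
  rw [← hw]
  rcases le_total 0 (w k) with h | h
  · simp [abs_of_nonneg h, ENNReal.ofReal_of_nonpos (neg_nonpos.2 h)]
  · simp [abs_of_nonpos h, ENNReal.ofReal_of_nonpos h]

/-! ### Uniform grids -/

/-- The points of the uniform grid of `[0, τ]` with `n + 1` steps. -/
noncomputable def uniformGrid (τ : ι → ℝ) (n : ℕ) (j : ι) (k : ℕ) : ℝ :=
  τ j * ((min k (n + 1) : ℕ) / (n + 1 : ℝ))

omit [Fintype ι] [DecidableEq ι] in
theorem uniformGrid_monotone {τ : ι → ℝ} (hτ : 0 ≤ τ) (n : ℕ) (j : ι) :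
    Monotone (uniformGrid τ n j) := by
  intro k l hkl
  refine mul_le_mul_of_nonneg_left (div_le_div_of_nonneg_right ?_ (by positivity)) (hτ j)
  exact_mod_cast min_le_min_right _ hkl

omit [Fintype ι] [DecidableEq ι] in
theorem uniformGrid_of_le (τ : ι → ℝ) {n : ℕ} (j : ι) {k : ℕ} (hk : n + 1 ≤ k) :
    uniformGrid τ n j k = τ j := by
  rw [uniformGrid, min_eq_right hk]
  push_cast
  rw [div_self (by positivity), mul_one]

omit [Fintype ι] [DecidableEq ι] in
theorem uniformGrid_zero (τ : ι → ℝ) (n : ℕ) (j : ι) : uniformGrid τ n j 0 = 0 := by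
  simp [uniformGrid]

omit [Fintype ι] [DecidableEq ι] in
theorem uniformGrid_mem {τ : ι → ℝ} (hτ : 0 ≤ τ) (n : ℕ) (j : ι) (k : ℕ) :
    uniformGrid τ n j k ∈ Set.Icc 0 (τ j) := by
  constructor
  · rw [← uniformGrid_zero τ n j]
    exact uniformGrid_monotone hτ n j (Nat.zero_le k)
  · rw [← uniformGrid_of_le τ j (le_max_right k (n + 1))]
    exact uniformGrid_monotone hτ n j (le_max_left k (n + 1))

omit [Fintype ι] [DecidableEq ι] in
theorem uniformGrid_succ_le {τ : ι → ℝ} (hτ : 0 ≤ τ) (n : ℕ) (j : ι) (k : ℕ) :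
    uniformGrid τ n j (k + 1) ≤ uniformGrid τ n j k + τ j / (n + 1) := by
  have h : ((min (k + 1) (n + 1) : ℕ) : ℝ) ≤ (min k (n + 1) : ℕ) + 1 := by
    exact_mod_cast (by omega : min (k + 1) (n + 1) ≤ min k (n + 1) + 1)
  calc uniformGrid τ n j (k + 1) ≤ τ j * (((min k (n + 1) : ℕ) + 1) / (n + 1 : ℝ)) :=
        mul_le_mul_of_nonneg_left (div_le_div_of_nonneg_right h (by positivity)) (hτ j)
    _ = uniformGrid τ n j k + τ j / (n + 1) := by rw [uniformGrid]; ring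

omit [Fintype ι] [DecidableEq ι] in
/-- The first index at which the uniform grid exceeds the level `a`, or the last index. -/
theorem exists_uniformGrid_index {τ : ι → ℝ} (hτ : 0 ≤ τ) (n : ℕ) (j : ι) {a : ℝ} (ha : 0 ≤ a) :
    ∃ p ≤ n + 1, (∀ k < n + 1, (uniformGrid τ n j k ≤ a ↔ k < p)) ∧
      min a (τ j) ≤ uniformGrid τ n j p ∧
        uniformGrid τ n j p ≤ min a (τ j) + τ j / (n + 1) := by
  classical
  have hex : ∃ k, n + 1 ≤ k ∨ a < uniformGrid τ n j k := ⟨n + 1, Or.inl le_rfl⟩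
  have hstep : 0 ≤ τ j / (n + 1 : ℝ) := div_nonneg (hτ j) (by positivity)
  refine ⟨Nat.find hex, Nat.find_min' hex (Or.inl le_rfl), fun k hk => ⟨fun h => ?_, fun h => ?_⟩,
    ?_, ?_⟩
  · by_contra hle
    rcases Nat.find_spec hex with h' | h'
    · omega
    · exact absurd (h'.trans_le (uniformGrid_monotone hτ n j (not_lt.1 hle))) (not_lt.2 h)
  · have := Nat.find_min hex h
    push Not at this
    exact this.2
  · rcases Nat.find_spec hex with h' | h'
    · rw [uniformGrid_of_le τ j h']
      exact min_le_right _ _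
    · exact (min_le_left _ _).trans h'.le
  · have h1 : uniformGrid τ n j (Nat.find hex) ≤ a + τ j / (n + 1) := by
      rcases Nat.eq_zero_or_pos (Nat.find hex) with h0 | h0
      · rw [h0, uniformGrid_zero]
        positivity
      · have := Nat.find_min hex (Nat.sub_lt h0 one_pos)
        push Not at this
        have h2 := uniformGrid_succ_le hτ n j (Nat.find hex - 1)
        rw [Nat.sub_add_cancel h0] at h2
        linarith [this.2]
    have h2 := (uniformGrid_mem hτ n j (Nat.find hex)).2
    rcases min_choice a (τ j) with h | h <;> rw [h] <;> linarith

/-- The discretization of an increment on the uniform grid. -/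
theorem exists_gridMeasure_box_eq {τ : ι → ℝ} (hτ : 0 ≤ τ) (G : (ι → ℝ) → ℝ) (n : ℕ)
    (w : (ι → ℕ) → ℝ) (hw : ∀ k, w k =
      increment G (fun j => uniformGrid τ n j (k j)) (fun j => uniformGrid τ n j (k j + 1)))
    {a b : ι → ℝ} (ha : 0 ≤ a) (hab : a ≤ b) :
    ∃ u v : ι → ℝ, u ∈ Set.Icc (a ⊓ τ) τ ∧ v ∈ Set.Icc (b ⊓ τ) τ ∧
      u ≤ a ⊓ τ + (fun j => τ j / (n + 1)) ∧ v ≤ b ⊓ τ + (fun j => τ j / (n + 1)) ∧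
      (gridMeasure (n + 1) (uniformGrid τ n) w).real (box a b) -
        (gridMeasure (n + 1) (uniformGrid τ n) (-w)).real (box a b) = increment G u v := by
  -- The atom of cell `k` sits at its lower corner, which lies in `(a, b]` exactly when `p ≤ k < q`
  -- coordinatewise. The sum thus telescopes to corners `g p`, `g q` that approach `a ⊓ τ`, `b ⊓ τ`
  -- from above, as right-continuity requires.
  choose p hp1 hp2 hp3 hp4 using fun j => exists_uniformGrid_index hτ n j (ha j)
  choose q hq1 hq2 hq3 hq4 using fun j => exists_uniformGrid_index hτ n j ((ha j).trans (hab j))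
  have hpq : p ≤ q := fun j => by
    by_contra h
    have h' : q j < p j := not_le.1 h
    have hlt : q j < n + 1 := h'.trans_le (hp1 j)
    exact lt_irrefl _ ((hq2 j _ hlt).1 (((hp2 j _ hlt).2 h').trans (hab j)))
  refine ⟨fun j => uniformGrid τ n j (p j), fun j => uniformGrid τ n j (q j),
    ⟨hp3, fun j => (uniformGrid_mem hτ n j _).2⟩, ⟨hq3, fun j => (uniformGrid_mem hτ n j _).2⟩,
    hp4, hq4, ?_⟩
  rw [gridMeasure_real_sub _ _ _ (measurableSet_box a b), ← sum_increment_Ico G _ p q hpq]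
  refine (Finset.sum_subset_zero_on_sdiff ?_ ?_ ?_).symm
  · intro k hk
    rw [Fintype.mem_piFinset] at hk ⊢
    exact fun j => Finset.mem_range.2 ((Finset.mem_Ico.1 (hk j)).2.trans_le (hq1 j))
  · intro k hk
    rw [Finset.mem_sdiff, Fintype.mem_piFinset, Fintype.mem_piFinset] at hk
    refine Set.indicator_of_notMem (fun hmem => hk.2 fun j => ?_) _
    have hj := Finset.mem_range.1 (hk.1 j)
    rw [Finset.mem_Ico]
    have := mem_box.1 hmem j
    exact ⟨not_lt.1 fun h => not_lt.2 ((hp2 j _ hj).2 h) this.1, (hq2 j _ hj).1 this.2⟩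
  · intro k hk
    rw [Fintype.mem_piFinset] at hk
    rw [Set.indicator_of_mem, hw]
    refine mem_box.2 fun j => ?_
    have h := Finset.mem_Ico.1 (hk j)
    have hj : k j < n + 1 := h.2.trans_le (hq1 j)
    exact ⟨not_le.1 fun h' => not_lt.2 h.1 ((hp2 j _ hj).1 h'), (hq2 j _ hj).2 h.2⟩

/-! ### Existence of the generated measure -/

/-- Each corner of the moving box approaches its limit from within the upper right quadrant. -/
theorem tendsto_increment {κ : Type*} {l : Filter κ} {τ : ι → ℝ} {G : (ι → ℝ) → ℝ}
    (hG : ∀ x ∈ Set.Icc 0 τ, ContinuousWithinAt G (Set.Icc x τ) x) {a b : ι → ℝ}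
    (ha : a ∈ Set.Icc 0 τ) (hb : b ∈ Set.Icc 0 τ) {u v : κ → ι → ℝ}
    (hu : Tendsto u l (𝓝 a)) (hv : Tendsto v l (𝓝 b)) (hu' : ∀ᶠ i in l, u i ∈ Set.Icc a τ)
    (hv' : ∀ᶠ i in l, v i ∈ Set.Icc b τ) :
    Tendsto (fun i => increment G (u i) (v i)) l (𝓝 (increment G a b)) := by
  refine tendsto_finsetSum _ fun t _ => Tendsto.const_mul _ ?_
  refine (hG (fun j => if j ∈ t then a j else b j) ?_).tendsto.comp
    (tendsto_nhdsWithin_iff.2 ⟨tendsto_pi_nhds.2 fun j => ?_, ?_⟩)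
  · constructor <;> intro j <;> dsimp only <;> split_ifs
    exacts [ha.1 j, hb.1 j, ha.2 j, hb.2 j]
  · by_cases hj : j ∈ t
    · simpa [hj] using tendsto_pi_nhds.1 hu j
    · simpa [hj] using tendsto_pi_nhds.1 hv j
  · filter_upwards [hu', hv'] with i hi1 hi2
    constructor <;> intro j <;> dsimp only <;> split_ifs
    exacts [hi1.1 j, hi2.1 j, hi1.2 j, hi2.2 j]

/-- Weak limits of the discretizations of `G` reproduce the increments of `G` over the boxes whose
faces are null for the limits. -/
theorem exists_measures_box_sub_eq_of_null_frontier {τ : ι → ℝ} (hτ : 0 ≤ τ) {G : (ι → ℝ) → ℝ}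
    (hG : ∀ x ∈ Set.Icc 0 τ, ContinuousWithinAt G (Set.Icc x τ) x)
    (hV : vitaliVariation τ G ≠ ∞) :
    ∃ P Q : FiniteMeasure (ι → ℝ),
      (P : Measure (ι → ℝ)) Set.univ + (Q : Measure (ι → ℝ)) Set.univ ≤ vitaliVariation τ G ∧
      ∀ a b : ι → ℝ, 0 ≤ a → a ≤ b → (P : Measure (ι → ℝ)) (frontier (box a b)) = 0 →
        (Q : Measure (ι → ℝ)) (frontier (box a b)) = 0 →
        (P : Measure (ι → ℝ)).real (box a b) - (Q : Measure (ι → ℝ)).real (box a b) =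
          increment G (a ⊓ τ) (b ⊓ τ) := by
  let w : ℕ → (ι → ℕ) → ℝ := fun n k =>
    increment G (fun j => uniformGrid τ n j (k j)) (fun j => uniformGrid τ n j (k j + 1))
  let Ps : ℕ → FiniteMeasure (ι → ℝ) := fun n =>
    ⟨gridMeasure (n + 1) (uniformGrid τ n) (w n), inferInstance⟩
  let Qs : ℕ → FiniteMeasure (ι → ℝ) := fun n =>
    ⟨gridMeasure (n + 1) (uniformGrid τ n) (-w n), inferInstance⟩
  have hmass : ∀ n, (Ps n : Measure (ι → ℝ)) Set.univ + (Qs n : Measure (ι → ℝ)) Set.univ ≤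
      vitaliVariation τ G := fun n =>
    gridMeasure_mass_add_le τ G (n + 1) (uniformGrid τ n)
      (fun j => ⟨uniformGrid_monotone hτ n j, uniformGrid_mem hτ n j⟩) (w n) fun _ => rfl
  have hsupp : ∀ n v, gridMeasure (n + 1) (uniformGrid τ n) v (Set.Icc 0 τ)ᶜ = 0 := by
    intro n v
    rw [gridMeasure_apply _ _ _ measurableSet_Icc.compl]
    refine Finset.sum_eq_zero fun k _ => ?_
    rw [Set.indicator_of_notMem, mul_zero]
    exact fun h => h ⟨fun j => (uniformGrid_mem hτ n j _).1, fun j => (uniformGrid_mem hτ n j _).2⟩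
  -- Bounded mass on a common compact set gives weak compactness. Using one ultrafilter provides
  -- limits of both parts without extracting subsequences.
  have hlim : ∀ R : ℕ → FiniteMeasure (ι → ℝ),
      (∀ n, (R n : Measure (ι → ℝ)) Set.univ ≤ vitaliVariation τ G) →
      (∀ n, (R n : Measure (ι → ℝ)) (Set.Icc 0 τ)ᶜ = 0) →
      ∃ S, Tendsto R (hyperfilter ℕ : Ultrafilter ℕ) (𝓝 S) := by
    intro R hR hR'
    obtain ⟨S, -, hS⟩ := (isCompact_setOfPred_finiteMeasure_le_of_isCompact
      (vitaliVariation τ G).toNNReal (isCompact_Icc (a := (0 : ι → ℝ)) (b := τ))).ultrafilter_le_nhds'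
        ((hyperfilter ℕ).map R) (by
          refine Ultrafilter.mem_map.2 (Filter.univ_mem' fun n => ⟨?_, ?_⟩)
          · exact ENNReal.toNNReal_mono hV (hR n)
          · rw [FiniteMeasure.null_iff_toMeasure_null]
            exact hR' n)
    exact ⟨S, hS⟩
  obtain ⟨P, hP⟩ := hlim Ps (fun n => le_self_add.trans (hmass n)) fun n => hsupp n _
  obtain ⟨Q, hQ⟩ := hlim Qs (fun n => le_add_self.trans (hmass n)) fun n => hsupp n _
  refine ⟨P, Q, ?_, fun a b ha hab hPf hQf => ?_⟩
  · refine le_of_tendsto (Tendsto.add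
      (tendsto_apply_of_tendsto_of_null_frontier hP MeasurableSet.univ (by simp))
      (tendsto_apply_of_tendsto_of_null_frontier hQ MeasurableSet.univ (by simp)))
      (Eventually.of_forall hmass)
  · have h1 := tendsto_apply_of_tendsto_of_null_frontier hP (measurableSet_box a b) hPf
    have h2 := tendsto_apply_of_tendsto_of_null_frontier hQ (measurableSet_box a b) hQf
    have h3 := ((ENNReal.tendsto_toReal (measure_ne_top _ _)).comp h1).sub
      ((ENNReal.tendsto_toReal (measure_ne_top _ _)).comp h2)
    choose u v hu hv hu' hv' huv using fun n =>
      exists_gridMeasure_box_eq hτ G n (w n) (fun _ => rfl) ha hab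
    have hb : (0 : ι → ℝ) ≤ b := ha.trans hab
    have hconv : ∀ (c : ι → ℝ) (x : ℕ → ι → ℝ), (∀ n, x n ∈ Set.Icc c τ) →
        (∀ n, x n ≤ c + fun j => τ j / ((n : ℝ) + 1)) → Tendsto x atTop (𝓝 c) := by
      intro c x hx hx'
      refine tendsto_pi_nhds.2 fun j => ?_
      refine tendsto_of_tendsto_of_tendsto_of_le_of_le (tendsto_const_nhds (x := c j)) ?_
        (fun n => (hx n).1 j) (fun n => hx' n j)
      have : Tendsto (fun n : ℕ => c j + τ j * (1 / ((n : ℝ) + 1))) atTop (𝓝 (c j + τ j * 0)) :=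
        (tendsto_one_div_add_atTop_nhds_zero_nat.const_mul _).const_add _
      simpa [div_eq_mul_inv] using this
    have h4 := (tendsto_increment hG (l := atTop) ⟨le_inf ha hτ, inf_le_right⟩
      ⟨le_inf hb hτ, inf_le_right⟩ (hconv _ u hu hu') (hconv _ v hv hv')
      (Eventually.of_forall hu) (Eventually.of_forall hv)).mono_left
        (Nat.hyperfilter_le_atTop)
    exact tendsto_nhds_unique h3 (h4.congr fun n => (huv n).symm)

omit [DecidableEq ι] in
-- Only countably many level sets of a coordinate can have positive mass, and a shift by `ε` moves
-- every face to a new level.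
theorem countable_setOf_frontier_box_pos (μ : Measure (ι → ℝ)) [SFinite μ] (a b : ι → ℝ) :
    {ε : ℝ | μ (frontier (box (fun j => a j + ε) (fun j => b j + ε))) ≠ 0}.Countable := by
  have h : ∀ (c : ι → ℝ) (j : ι), {ε : ℝ | 0 < μ {x | x j = c j + ε}}.Countable := fun c j =>
    (Measure.countable_meas_level_set_pos (μ := μ) (measurable_pi_apply j)).preimage
      (add_right_injective (c j))
  refine (Set.countable_iUnion fun j => (h a j).union (h b j)).mono fun ε hε => ?_
  by_contra hne
  simp only [Set.mem_iUnion, Set.mem_union, Set.mem_ofPred_eq, not_exists, not_or, not_lt,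
    nonpos_iff_eq_zero] at hne
  refine hε (measure_mono_null (frontier_box_subset _ _) (measure_iUnion_null fun j => ?_))
  exact measure_union_null (hne j).1 (hne j).2

omit [DecidableEq ι] in
-- Strictness at `a` and weakness at `b` both survive as `ε` decreases to 0, so the indicators
-- converge pointwise. The set `S` will select the shifts with null faces.
theorem tendsto_measureReal_box_add (μ : Measure (ι → ℝ)) [IsFiniteMeasure μ] (a b : ι → ℝ)
    (S : Set ℝ) : Tendsto (fun ε : ℝ => μ.real (box (fun j => a j + ε) (fun j => b j + ε)))
      (𝓝[Set.Ioi 0 ∩ S] 0) (𝓝 (μ.real (box a b))) := by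
  refine (ENNReal.tendsto_toReal (measure_ne_top _ _)).comp ?_
  refine tendsto_measure_of_tendsto_indicator _ (fun ε => measurableSet_box _ _)
    MeasurableSet.univ (measure_ne_top _ _) (Eventually.of_forall fun _ => Set.subset_univ _)
    fun x => ?_
  have hpos : ∀ᶠ ε : ℝ in 𝓝[Set.Ioi 0 ∩ S] 0, 0 < ε :=
    eventually_nhdsWithin_of_forall fun ε hε => hε.1
  have hsmall : ∀ᶠ ε : ℝ in 𝓝[Set.Ioi 0 ∩ S] 0, ∀ j,
      (a j < x j → a j + ε < x j) ∧ (b j < x j → b j + ε < x j) := by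
    refine eventually_all.2 fun j => mem_nhdsWithin_of_mem_nhds ?_
    have : ∀ c y : ℝ, ∀ᶠ ε : ℝ in 𝓝 0, c < y → c + ε < y := by
      intro c y
      by_cases h : c < y
      · have : Tendsto (fun ε => c + ε) (𝓝 0) (𝓝 (c + 0)) :=
          tendsto_id.const_add c
        filter_upwards [this.eventually_lt_const (by simpa using h)] with ε hε _ using hε
      · simp [h]
    exact (this _ _).and (this _ _)
  filter_upwards [hpos, hsmall] with ε h0 h1
  rw [mem_box, mem_box]
  refine forall_congr' fun j => ⟨fun h => ⟨by linarith [h.1], ?_⟩,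
    fun h => ⟨(h1 j).1 h.1, by linarith [h.2]⟩⟩
  by_contra hlt
  exact absurd ((h1 j).2 (not_le.1 hlt)) (not_lt.2 h.2)

theorem exists_isGeneratedBy {τ : ι → ℝ} (hτ : 0 ≤ τ) {G : (ι → ℝ) → ℝ}
    (hG : ∀ x ∈ Set.Icc 0 τ, ContinuousWithinAt G (Set.Icc x τ) x)
    (hV : vitaliVariation τ G ≠ ∞) :
    ∃ μ, IsGeneratedBy τ G μ ∧ μ.variation (box 0 τ) ≤ vitaliVariation τ G := by
  obtain ⟨P, Q, hmass, hPQ⟩ := exists_measures_box_sub_eq_of_null_frontier hτ hG hV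
  have hbox := measurableSet_box (0 : ι → ℝ) τ
  have key : ∀ a b : ι → ℝ, 0 ≤ a → a ≤ b → b ≤ τ →
      (P : Measure (ι → ℝ)).real (box a b) - (Q : Measure (ι → ℝ)).real (box a b) =
        increment G a b := by
    intro a b ha hab hb
    set S : Set ℝ := {ε : ℝ | (P : Measure (ι → ℝ))
        (frontier (box (fun j => a j + ε) (fun j => b j + ε))) ≠ 0} ∪
      {ε : ℝ | (Q : Measure (ι → ℝ))
        (frontier (box (fun j => a j + ε) (fun j => b j + ε))) ≠ 0} with hS
    have hcount : S.Countable := (countable_setOf_frontier_box_pos _ a b).union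
      (countable_setOf_frontier_box_pos _ a b)
    -- The complement of a countable set is dense, so 0 is a limit of good positive shifts.
    have hne : (𝓝[Set.Ioi 0 ∩ Sᶜ] (0 : ℝ)).NeBot := by
      rw [← mem_closure_iff_nhdsWithin_neBot]
      refine closure_minimal ((hcount.dense_compl ℝ).open_subset_closure_inter isOpen_Ioi)
        isClosed_closure ?_
      rw [closure_Ioi]
      exact Set.self_mem_Ici
    have h1 := (tendsto_measureReal_box_add (P : Measure (ι → ℝ)) a b Sᶜ).sub
      (tendsto_measureReal_box_add (Q : Measure (ι → ℝ)) a b Sᶜ)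
    have hshift : ∀ c : ι → ℝ, 0 ≤ c → c ≤ τ →
        Tendsto (fun ε : ℝ => (fun j => c j + ε) ⊓ τ) (𝓝[Set.Ioi 0 ∩ Sᶜ] 0) (𝓝 c) ∧
        ∀ᶠ ε in 𝓝[Set.Ioi 0 ∩ Sᶜ] (0 : ℝ), (fun j => c j + ε) ⊓ τ ∈ Set.Icc c τ := by
      intro c hc hcτ
      constructor
      · have : Continuous fun ε : ℝ => (fun j => c j + ε) ⊓ τ := continuous_pi fun j =>
          (continuous_const.add continuous_id).inf continuous_const
        have h := (this.tendsto 0).mono_left (nhdsWithin_le_nhds (s := Set.Ioi 0 ∩ Sᶜ))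
        simpa [inf_eq_left.2 hcτ] using h
      · refine eventually_nhdsWithin_of_forall fun ε hε => ⟨le_inf (fun j => ?_) hcτ, inf_le_right⟩
        exact le_add_of_nonneg_right (le_of_lt hε.1)
    have hb0 : (0 : ι → ℝ) ≤ b := ha.trans hab
    have haτ : a ≤ τ := hab.trans hb
    have h2 := tendsto_increment hG ⟨ha, haτ⟩ ⟨hb0, hb⟩ (hshift a ha haτ).1 (hshift b hb0 hb).1
      (hshift a ha haτ).2 (hshift b hb0 hb).2
    refine tendsto_nhds_unique h1 (h2.congr' ?_)
    refine eventually_nhdsWithin_of_forall fun ε hε => ?_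
    have hε2 := hε.2
    simp only [hS, Set.mem_compl_iff, Set.mem_union, Set.mem_ofPred_eq, not_or, not_not] at hε2
    refine (hPQ _ _ (fun j => ?_) (fun j => ?_) hε2.1 hε2.2).symm
    · exact add_nonneg (ha j) (le_of_lt hε.1)
    · exact add_le_add_left (hab j) _
  -- Restriction removes any mass that the weak limits carry outside `(0, τ]`, such as on the lower
  -- faces.
  refine ⟨((P : Measure (ι → ℝ)).toSignedMeasure -
    (Q : Measure (ι → ℝ)).toSignedMeasure).restrict (box 0 τ), ⟨fun a b ha hab hb => ?_,
      fun A hA => ?_⟩, ?_⟩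
  · rw [VectorMeasure.restrict_apply _ hbox (measurableSet_box a b),
      Set.inter_eq_left.2 (box_subset_box ha hb),
      Measure.toSignedMeasure_sub_apply (measurableSet_box a b)]
    exact key a b ha hab hb
  · by_cases hm : MeasurableSet A
    · rw [VectorMeasure.restrict_apply _ hbox hm, hA.inter_eq, VectorMeasure.empty]
    · exact VectorMeasure.not_measurable _ hm
  · refine le_trans ?_ hmass
    refine (VectorMeasure.variation_restrict_le _).trans ?_
    refine (Measure.restrict_apply_le _ _).trans ?_
    refine (VectorMeasure.variation_sub_le _).trans ?_
    rw [Measure.variation_toSignedMeasure, Measure.variation_toSignedMeasure, Measure.add_apply]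
    exact add_le_add (measure_mono (Set.subset_univ _)) (measure_mono (Set.subset_univ _))

/-! ### Sections -/

omit [Fintype ι] in
theorem continuous_zeroExtend (s : Finset ι) : Continuous (zeroExtend s) := by
  refine continuous_pi fun j => ?_
  by_cases hj : j ∈ s
  · simpa [zeroExtend, hj] using continuous_apply (⟨j, hj⟩ : s)
  · simpa [zeroExtend, hj] using continuous_const

omit [Fintype ι] in
theorem zeroExtend_le_iff {s : Finset ι} {u : s → ℝ} {x : ι → ℝ} (hx : 0 ≤ x) :
    zeroExtend s u ≤ x ↔ u ≤ corner x s := by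
  refine ⟨fun h j => ?_, fun h j => ?_⟩
  · simpa [zeroExtend, corner] using h j
  · by_cases hj : j ∈ s
    · simpa [zeroExtend, corner, hj] using h ⟨j, hj⟩
    · simpa [zeroExtend, hj] using hx j

omit [Fintype ι] in
theorem zeroExtend_nonneg_iff {s : Finset ι} {u : s → ℝ} : 0 ≤ zeroExtend s u ↔ 0 ≤ u := by
  refine ⟨fun h j => ?_, fun h j => ?_⟩
  · simpa [zeroExtend] using h j
  · by_cases hj : j ∈ s
    · simpa [zeroExtend, hj] using h ⟨j, hj⟩
    · simp [zeroExtend, hj]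

omit [Fintype ι] in
theorem zeroExtend_mono (s : Finset ι) : Monotone (zeroExtend s) := by
  intro u v h j
  by_cases hj : j ∈ s
  · simpa [zeroExtend, hj] using h ⟨j, hj⟩
  · simp [zeroExtend, hj]

omit [Fintype ι] in
theorem IsCadlag.continuousWithinAt_Icc {τ : ι → ℝ} {F : (ι → ℝ) → ℝ} (hF : IsCadlag τ F)
    {x : ι → ℝ} (hx : x ∈ Set.Icc 0 τ) : ContinuousWithinAt F (Set.Icc x τ) x := by
  refine (hF x hx).2.mono fun y hy => ⟨⟨hx.1.trans hy.1, hy.2⟩, fun j => ?_⟩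
  simpa using hy.1 j

omit [Fintype ι] in
theorem IsCadlag.sect_continuousWithinAt {τ : ι → ℝ} (hτ : 0 ≤ τ) {F : (ι → ℝ) → ℝ}
    (hF : IsCadlag τ F) (s : Finset ι) :
    ∀ u ∈ Set.Icc 0 (corner τ s), ContinuousWithinAt (sect F s) (Set.Icc u (corner τ s)) u := by
  intro u hu
  have h := hF.continuousWithinAt_Icc
    ⟨zeroExtend_nonneg_iff.2 hu.1, (zeroExtend_le_iff hτ).2 hu.2⟩
  exact h.comp (continuous_zeroExtend s).continuousWithinAt
    fun v hv => ⟨zeroExtend_mono s hv.1, (zeroExtend_le_iff hτ).2 hv.2⟩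

theorem vitaliVariation_sect_ne_top {τ : ι → ℝ} {F : (ι → ℝ) → ℝ}
    (hF : sectionalVariationNorm τ F < ∞) {s : Finset ι} (hs : s ∈ sections ι) :
    vitaliVariation (corner τ s) (sect F s) ≠ ∞ := by
  rw [sectionalVariationNorm, ENNReal.add_lt_top, ENNReal.sum_lt_top] at hF
  exact (hF.2 s hs).ne

omit [Fintype ι] [DecidableEq ι] in
theorem corner_nonneg {τ : ι → ℝ} (hτ : 0 ≤ τ) (s : Finset ι) : 0 ≤ corner τ s := fun j => hτ j

/-- A cadlag function of bounded sectional variation. -/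
structure HasBoundedSectionalVariation (τ : ι → ℝ) (F : (ι → ℝ) → ℝ) : Prop where
  cadlag : IsCadlag τ F
  lt_top : sectionalVariationNorm τ F < ∞

namespace HasBoundedSectionalVariation

variable {τ : ι → ℝ} {F : (ι → ℝ) → ℝ}

theorem exists_isGeneratedBy_sect (h : HasBoundedSectionalVariation τ F) (hτ : 0 ≤ τ)
    {s : Finset ι} (hs : s ∈ sections ι) :
    ∃ μ, IsGeneratedBy (corner τ s) (sect F s) μ ∧
      μ.variation (box 0 (corner τ s)) ≤ vitaliVariation (corner τ s) (sect F s) :=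
  exists_isGeneratedBy (corner_nonneg hτ s) (h.cadlag.sect_continuousWithinAt hτ s)
    (vitaliVariation_sect_ne_top h.lt_top hs)

theorem isGeneratedBy_sectMeasure (h : HasBoundedSectionalVariation τ F) (hτ : 0 ≤ τ)
    {s : Finset ι} (hs : s ∈ sections ι) :
    IsGeneratedBy (corner τ s) (sect F s) (sectMeasure τ F s) := by
  obtain ⟨μ, hμ, -⟩ := h.exists_isGeneratedBy_sect hτ hs
  rw [sectMeasure, generatedMeasure, dif_pos ⟨μ, hμ⟩]
  exact Exists.choose_spec (p := IsGeneratedBy (corner τ s) (sect F s)) _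

theorem existsUnique_isGeneratedBy_sect (h : HasBoundedSectionalVariation τ F) (hτ : 0 ≤ τ)
    {s : Finset ι} (hs : s ∈ sections ι) : ∃! μ, IsGeneratedBy (corner τ s) (sect F s) μ :=
  ⟨_, h.isGeneratedBy_sectMeasure hτ hs,
    fun _ hν => hν.unique (corner_nonneg hτ s) (h.isGeneratedBy_sectMeasure hτ hs)⟩

/-- For ≤, uniqueness identifies the chosen measure with the weak limit, whose variation was bounded
by its construction. -/
theorem variation_sectMeasure (h : HasBoundedSectionalVariation τ F) (hτ : 0 ≤ τ)
    {s : Finset ι} (hs : s ∈ sections ι) :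
    (sectMeasure τ F s).variation (box 0 (corner τ s)) =
      vitaliVariation (corner τ s) (sect F s) := by
  refine le_antisymm ?_ (vitaliVariation_le_variation (h.isGeneratedBy_sectMeasure hτ hs))
  obtain ⟨μ, hμ, hle⟩ := h.exists_isGeneratedBy_sect hτ hs
  rwa [(h.isGeneratedBy_sectMeasure hτ hs).unique (corner_nonneg hτ s) hμ]

/-- A function of bounded sectional variation is recovered from the measures of its sections. -/
theorem eq_add_sum_sectMeasure (h : HasBoundedSectionalVariation τ F) (hτ : 0 ≤ τ)
    {x : ι → ℝ} (hx : x ∈ Set.Icc 0 τ) :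
    F x = F 0 + ∑ s ∈ sections ι, sectMeasure τ F s (box 0 (corner x s)) := by
  rw [eq_add_sum_increment_sect F x]
  congr 1
  refine Finset.sum_congr rfl fun s hs => ?_
  rw [(h.isGeneratedBy_sectMeasure hτ hs).1 _ _ le_rfl (corner_nonneg hx.1 s) fun j => hx.2 j]

/-- The witness puts the atom `F 0` at the origin and pushes each section measure onto its face.
Pulled back to the face of `s`, `[0, x]` meets `(0, τ_s]` in `(0, x_s]`, so the masses sum to `F x`.
-/
theorem exists_hasDistribution (h : HasBoundedSectionalVariation τ F) (hτ : 0 ≤ τ) :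
    ∃ ν, HasDistribution τ F ν := by
  have happly : ∀ A : Set (ι → ℝ), MeasurableSet A →
      (VectorMeasure.dirac 0 (F 0) +
        ∑ s ∈ sections ι, (sectMeasure τ F s).map (zeroExtend s) : SignedMeasure (ι → ℝ)) A =
      VectorMeasure.dirac 0 (F 0) A +
        ∑ s ∈ sections ι, sectMeasure τ F s (zeroExtend s ⁻¹' A) := by
    intro A hA
    rw [add_apply, sum_apply]
    congr 1
    exact Finset.sum_congr rfl fun s _ =>
      VectorMeasure.map_apply _ (continuous_zeroExtend s).measurable hA
  refine ⟨VectorMeasure.dirac 0 (F 0) +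
    ∑ s ∈ sections ι, (sectMeasure τ F s).map (zeroExtend s), fun x hx => ?_, fun A hA => ?_⟩
  · rw [happly _ measurableSet_Icc, h.eq_add_sum_sectMeasure hτ hx,
      VectorMeasure.dirac_apply_of_mem measurableSet_Icc ⟨le_rfl, hx.1⟩]
    congr 1
    refine Finset.sum_congr rfl fun s hs => ?_
    rw [← apply_inter_of_support (measurableSet_box 0 (corner τ s))
      (h.isGeneratedBy_sectMeasure hτ hs).2
      ((continuous_zeroExtend s).measurable measurableSet_Icc)]
    congr 1
    ext u
    simp only [Set.mem_inter_iff, Set.mem_preimage, Set.mem_Icc, zeroExtend_nonneg_iff,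
      zeroExtend_le_iff hx.1, mem_box]
    exact ⟨fun hu j => ⟨(hu.2 j).1, hu.1.2 j⟩,
      fun hu => ⟨⟨fun j => (hu j).1.le, fun j => (hu j).2⟩,
        fun j => ⟨(hu j).1, (hu j).2.trans (hx.2 j)⟩⟩⟩
  · by_cases hm : MeasurableSet A
    · rw [happly A hm, VectorMeasure.dirac_apply_of_notMem, zero_add]
      · refine Finset.sum_eq_zero fun s hs => (h.isGeneratedBy_sectMeasure hτ hs).2 _ ?_
        refine Set.disjoint_left.2 fun u huA hu => Set.disjoint_left.1 hA huA ?_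
        exact ⟨zeroExtend_nonneg_iff.2 fun j => (mem_box.1 hu j).1.le,
          (zeroExtend_le_iff hτ).2 fun j => (mem_box.1 hu j).2⟩
      · exact fun h0 => Set.disjoint_left.1 hA h0 ⟨le_rfl, hτ⟩
    · exact VectorMeasure.not_measurable _ hm

theorem hasDistribution_cubeMeasure (h : HasBoundedSectionalVariation τ F) (hτ : 0 ≤ τ) :
    HasDistribution τ F (cubeMeasure τ F) := by
  rw [cubeMeasure, dif_pos (h.exists_hasDistribution hτ)]
  exact Exists.choose_spec (p := HasDistribution τ F) _

end HasBoundedSectionalVariation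

/-! ### Integration by parts -/

instance {X : Type*} [MeasurableSpace X] (μ : SignedMeasure X) : IsFiniteMeasure μ.variation := by
  rw [← SignedMeasure.totalVariation_eq_variation]
  infer_instance

/-- Fubini's theorem for the indicator of a measurable set and two signed measures. -/
theorem integral_prodMk_left_eq_integral_prodMk_right {X Y : Type*} [MeasurableSpace X]
    [MeasurableSpace Y] (μ : SignedMeasure X) (ν : SignedMeasure Y) {S : Set (X × Y)}
    (hS : MeasurableSet S) :
    ∫ᵛ x, ν (Prod.mk x ⁻¹' S) ∂•μ = ∫ᵛ y, μ ((fun x => (x, y)) ⁻¹' S) ∂•ν := by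
  have hflip : (ContinuousLinearMap.lsmul ℝ ℝ : ℝ →L[ℝ] ℝ →L[ℝ] ℝ).flip =
      ContinuousLinearMap.lsmul ℝ ℝ := by
    ext; simp
  have h1 := VectorMeasure.prod_apply_eq_integral (μ := μ) (ν := ν)
    (B := ContinuousLinearMap.lsmul ℝ ℝ) hS
  have h2 := VectorMeasure.prod_apply_eq_integral (μ := ν) (ν := μ)
    (B := ContinuousLinearMap.lsmul ℝ ℝ) (measurable_swap hS)
  -- Multiplication commutes, so both sides agree on rectangles, which determine the product.
  have h3 : ν.prod μ (ContinuousLinearMap.lsmul ℝ ℝ) =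
      (μ.prod ν (ContinuousLinearMap.lsmul ℝ ℝ)).map Prod.swap := by
    refine VectorMeasure.prod_eq_of_forall_apply_prod fun s t hs ht => ?_
    rw [VectorMeasure.map_apply _ measurable_swap (hs.prod ht), Set.preimage_swap_prod,
      VectorMeasure.prod_apply]
    simp [mul_comm]
  rw [hflip] at h1 h2
  rw [← h1]
  refine Eq.trans ?_ h2
  rw [h3, VectorMeasure.map_apply _ measurable_swap (measurable_swap hS)]
  rfl

omit [Fintype ι] [DecidableEq ι] in
/-- The pairs of a point `x` of the cube and a point `u` of `(0, x_s]`. -/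
def belowSet (τ : ι → ℝ) (s : Finset ι) : Set ((ι → ℝ) × (s → ℝ)) :=
  {p | p.1 ∈ Set.Icc 0 τ ∧ p.2 ∈ box 0 (corner p.1 s)}

omit [DecidableEq ι] in
theorem measurableSet_belowSet (τ : ι → ℝ) (s : Finset ι) : MeasurableSet (belowSet τ s) := by
  refine (measurable_fst measurableSet_Icc).inter ?_
  have : {p : (ι → ℝ) × (s → ℝ) | p.2 ∈ box 0 (corner p.1 s)} =
      ⋂ j, {p | 0 < p.2 j} ∩ {p | p.2 j ≤ p.1 j} := by
    ext p
    simp [mem_box, corner]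
  change MeasurableSet {p : (ι → ℝ) × (s → ℝ) | p.2 ∈ box 0 (corner p.1 s)}
  rw [this]
  refine MeasurableSet.iInter fun j => ?_
  exact (measurableSet_lt (by fun_prop) (by fun_prop)).inter
    (measurableSet_le (by fun_prop) (by fun_prop))

omit [Fintype ι] [DecidableEq ι] in
theorem indicator_apply_prodMk_belowSet (τ : ι → ℝ) (s : Finset ι) (μ : SignedMeasure (s → ℝ)) :
    (fun x => μ (Prod.mk x ⁻¹' belowSet τ s)) =
      (Set.Icc 0 τ).indicator fun x => μ (box 0 (corner x s)) := by
  ext x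
  by_cases hx : x ∈ Set.Icc 0 τ
  · rw [Set.indicator_of_mem hx]
    congr 1
    ext u
    simp only [belowSet, Set.mem_preimage, Set.mem_ofPred_eq, hx, true_and]
  · rw [Set.indicator_of_notMem hx]
    convert VectorMeasure.empty μ
    ext u
    simp only [belowSet, Set.mem_preimage, Set.mem_ofPred_eq, hx, false_and, Set.mem_empty_iff_false]

omit [Fintype ι] in
-- For `x ≥ 0` the condition `u ≤ x_s` is `zeroExtend s u ≤ x`; this is how Z̄ enters.
theorem indicator_apply_belowSet_prodMk (τ : ι → ℝ) (s : Finset ι) (ν : SignedMeasure (ι → ℝ)) :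
    (fun u => ν ((fun x => (x, u)) ⁻¹' belowSet τ s)) =
      (box 0 (corner τ s)).indicator fun u => ν (Set.Icc (zeroExtend s u) τ) := by
  ext u
  by_cases hu : u ∈ box 0 (corner τ s)
  · rw [Set.indicator_of_mem hu]
    congr 1
    ext x
    simp only [belowSet, Set.mem_preimage, Set.mem_ofPred_eq, Set.mem_Icc]
    have hu0 : 0 ≤ u := fun j => (mem_box.1 hu j).1.le
    constructor
    · rintro ⟨⟨h0, hτ⟩, hx⟩
      exact ⟨(zeroExtend_le_iff h0).2 fun j => (mem_box.1 hx j).2, hτ⟩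
    · rintro ⟨hx, hτ⟩
      have h0 : 0 ≤ x := (zeroExtend_nonneg_iff.2 hu0).trans hx
      exact ⟨⟨h0, hτ⟩, mem_box.2 fun j =>
        ⟨(mem_box.1 hu j).1, (zeroExtend_le_iff h0).1 hx j⟩⟩
  · rw [Set.indicator_of_notMem hu]
    convert VectorMeasure.empty ν
    ext x
    simp only [belowSet, Set.mem_preimage, Set.mem_ofPred_eq, Set.mem_Icc, Set.mem_empty_iff_false,
      iff_false]
    rintro ⟨⟨h0, hτ⟩, hx⟩
    exact hu (box_subset_box le_rfl (fun j : s => hτ j) hx)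

omit [DecidableEq ι] in
theorem integrableOn_apply_box_corner (τ : ι → ℝ) (s : Finset ι) (μ : SignedMeasure (s → ℝ))
    (ν : SignedMeasure (ι → ℝ)) :
    ν.IntegrableOn (fun x => μ (box 0 (corner x s))) (Set.Icc 0 τ) := by
  rw [← VectorMeasure.integrable_indicator_iff measurableSet_Icc,
    ← indicator_apply_prodMk_belowSet]
  exact VectorMeasure.integrable_vectorMeasure_prodMk_left (measurableSet_belowSet τ s)

theorem integrableOn_apply_Icc_zeroExtend (τ : ι → ℝ) (s : Finset ι) (μ : SignedMeasure (s → ℝ))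
    (ν : SignedMeasure (ι → ℝ)) :
    μ.IntegrableOn (fun u => ν (Set.Icc (zeroExtend s u) τ)) (box 0 (corner τ s)) := by
  have h : μ.Integrable fun u => ν (Prod.mk u ⁻¹' (Prod.swap ⁻¹' belowSet τ s)) :=
    VectorMeasure.integrable_vectorMeasure_prodMk_left
      (measurable_swap (measurableSet_belowSet τ s))
  have h' : (fun u => ν (Prod.mk u ⁻¹' (Prod.swap ⁻¹' belowSet τ s))) =
      (box 0 (corner τ s)).indicator fun u => ν (Set.Icc (zeroExtend s u) τ) :=
    indicator_apply_belowSet_prodMk τ s ν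
  rw [h'] at h
  exact (VectorMeasure.integrable_indicator_iff (measurableSet_box _ _)).1 h

/-- Fubini for the indicator of `belowSet`: the two sides integrate its sections in the two orders.
-/
theorem setIntegral_apply_box_corner (τ : ι → ℝ) (s : Finset ι) (μ : SignedMeasure (s → ℝ))
    (ν : SignedMeasure (ι → ℝ)) :
    ∫ᵛ x in Set.Icc 0 τ, μ (box 0 (corner x s)) ∂•ν =
      ∫ᵛ u in box 0 (corner τ s), ν (Set.Icc (zeroExtend s u) τ) ∂•μ := by
  rw [← VectorMeasure.integral_indicator measurableSet_Icc,
    ← VectorMeasure.integral_indicator (measurableSet_box _ _),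
    ← indicator_apply_prodMk_belowSet, ← indicator_apply_belowSet_prodMk]
  exact integral_prodMk_left_eq_integral_prodMk_right ν μ (measurableSet_belowSet τ s)

namespace HasBoundedSectionalVariation

variable {τ : ι → ℝ} {F : (ι → ℝ) → ℝ}

/-- Measurability of `F` on the cube also comes from its representation by section measures. -/
theorem integrableOn (h : HasBoundedSectionalVariation τ F) (hτ : 0 ≤ τ)
    (ν : SignedMeasure (ι → ℝ)) : ν.IntegrableOn F (Set.Icc 0 τ) := by
  rw [← VectorMeasure.integrable_indicator_iff measurableSet_Icc,
    Set.indicator_congr fun x hx => h.eq_add_sum_sectMeasure hτ hx,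
    VectorMeasure.integrable_indicator_iff measurableSet_Icc]
  exact (integrable_const (F 0)).add
    (integrable_finsetSum _ fun s _ => integrableOn_apply_box_corner τ s _ ν)

theorem setIntegral_eq (h : HasBoundedSectionalVariation τ F) (hτ : 0 ≤ τ)
    (ν : SignedMeasure (ι → ℝ)) :
    ∫ᵛ x in Set.Icc 0 τ, F x ∂•ν = F 0 * ν (Set.Icc 0 τ) +
      ∑ s ∈ sections ι, ∫ᵛ u in box 0 (corner τ s), ν (Set.Icc (zeroExtend s u) τ)
        ∂•(sectMeasure τ F s) := by
  rw [VectorMeasure.setIntegral_congr_fun fun x hx => h.eq_add_sum_sectMeasure hτ hx,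
    VectorMeasure.integral_fun_add (integrable_const (F 0))
      (integrable_finsetSum _ fun s _ => integrableOn_apply_box_corner τ s _ ν),
    VectorMeasure.integral_finsetSum _ fun s _ => integrableOn_apply_box_corner τ s _ ν,
    VectorMeasure.setIntegral_const]
  simp_rw [setIntegral_apply_box_corner]
  rfl

end HasBoundedSectionalVariation

omit [Fintype ι] [DecidableEq ι] in
-- A finite signed measure is bounded over all sets.
theorem bddAbove_range_abs_upper (τ : ι → ℝ) (Z : (ι → ℝ) → ℝ) :
    BddAbove (Set.range fun u : Set.Icc (0 : ι → ℝ) τ => |upper τ Z u|) :=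
  ⟨VectorMeasure.bound (cubeMeasure τ Z), by
    rintro - ⟨u, rfl⟩
    exact (Real.norm_eq_abs _).symm.trans_le VectorMeasure.norm_apply_le_bound⟩

omit [Fintype ι] [DecidableEq ι] in
theorem abs_upper_le_supNorm {τ : ι → ℝ} (Z : (ι → ℝ) → ℝ) {u : ι → ℝ} (hu : u ∈ Set.Icc 0 τ) :
    |upper τ Z u| ≤ supNorm τ (upper τ Z) :=
  le_ciSup (bddAbove_range_abs_upper τ Z) (⟨u, hu⟩ : Set.Icc (0 : ι → ℝ) τ)

theorem HasBoundedSectionalVariation.setIntegral_le {τ : ι → ℝ} {F : (ι → ℝ) → ℝ}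
    (h : HasBoundedSectionalVariation τ F) (hτ : 0 ≤ τ) (Z : (ι → ℝ) → ℝ) :
    ∫ᵛ x in Set.Icc 0 τ, F x ∂•(cubeMeasure τ Z) ≤
      supNorm τ (upper τ Z) * (sectionalVariationNorm τ F).toReal := by
  have hsum : (∑ s ∈ sections ι, vitaliVariation (corner τ s) (sect F s)) ≠ ∞ := by
    rw [ENNReal.sum_ne_top]
    exact fun s hs => vitaliVariation_sect_ne_top h.lt_top hs
  rw [h.setIntegral_eq hτ, sectionalVariationNorm, ENNReal.toReal_add ENNReal.ofReal_ne_top hsum,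
    ENNReal.toReal_ofReal (abs_nonneg _), ENNReal.toReal_sum
      (fun s hs => vitaliVariation_sect_ne_top h.lt_top hs), mul_add, Finset.mul_sum]
  refine add_le_add ?_ (Finset.sum_le_sum fun s hs => ?_)
  · refine (le_abs_self _).trans ?_
    rw [abs_mul, mul_comm]
    exact mul_le_mul_of_nonneg_right (abs_upper_le_supNorm Z ⟨le_rfl, hτ⟩) (abs_nonneg _)
  · rw [← h.variation_sectMeasure hτ hs]
    refine (le_abs_self _).trans ?_
    have hC : ∀ u ∈ box 0 (corner τ s), ‖upper τ Z (zeroExtend s u)‖ ≤ supNorm τ (upper τ Z) :=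
      fun u hu => abs_upper_le_supNorm Z
        ⟨zeroExtend_nonneg_iff.2 fun j => (mem_box.1 hu j).1.le,
          (zeroExtend_le_iff hτ).2 fun j => (mem_box.1 hu j).2⟩
    refine (VectorMeasure.norm_setIntegral_le_of_norm_le_const
      (B := (ContinuousLinearMap.lsmul ℝ ℝ : ℝ →L[ℝ] ℝ →L[ℝ] ℝ)) hC).trans ?_
    refine mul_le_mul_of_nonneg_right ?_ measureReal_nonneg
    -- The norm of the pairing that defines the integral appears as a factor in the estimate.
    have hB : ‖(ContinuousLinearMap.lsmul ℝ ℝ : ℝ →L[ℝ] ℝ →L[ℝ] ℝ)‖ ≤ 1 :=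
      ContinuousLinearMap.opNorm_lsmul_le
    exact mul_le_of_le_one_right
      ((abs_nonneg _).trans (abs_upper_le_supNorm Z ⟨le_rfl, hτ⟩)) hB

end Sectional

/-- Integration by parts on the cube for cadlag functions of bounded sectional variation. -/
theorem mainTheorem12 (d : ℕ) (τ : Fin d → ℝ) (hτ : 0 ≤ τ) (F Z : (Fin d → ℝ) → ℝ)
    (hF : Sectional.IsCadlag τ F) (hZ : Sectional.IsCadlag τ Z)
    (hFv : Sectional.sectionalVariationNorm τ F < ∞)
    (hZv : Sectional.sectionalVariationNorm τ Z < ∞) :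
    -- the measures `dZ` on `[0, τ]` and `dF_s` on `(0_s, τ_s]` exist and are unique, and the
    -- variation in the sectional variation norm is the total variation of `dF_s`
    (∃! ν, Sectional.HasDistribution τ Z ν) ∧
    (∀ s ∈ Sectional.sections (Fin d),
      (∃! μ, Sectional.IsGeneratedBy (Sectional.corner τ s) (Sectional.sect F s) μ) ∧
      (Sectional.sectMeasure τ F s).variation (Sectional.box 0 (Sectional.corner τ s)) =
        Sectional.vitaliVariation (Sectional.corner τ s) (Sectional.sect F s)) ∧
    -- the integrals converge absolutely
    (Sectional.cubeMeasure τ Z).IntegrableOn F (Set.Icc 0 τ) ∧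
    (∀ s ∈ Sectional.sections (Fin d),
      (Sectional.sectMeasure τ F s).IntegrableOn
        (fun u => Sectional.upper τ Z (Sectional.zeroExtend s u))
        (Sectional.box 0 (Sectional.corner τ s))) ∧
    -- integration by parts
    ∫ᵛ x in Set.Icc 0 τ, F x ∂•(Sectional.cubeMeasure τ Z) =
      F 0 * Sectional.upper τ Z 0 +
        ∑ s ∈ Sectional.sections (Fin d),
          ∫ᵛ u in Sectional.box 0 (Sectional.corner τ s),
            Sectional.upper τ Z (Sectional.zeroExtend s u) ∂•(Sectional.sectMeasure τ F s) ∧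
    -- the bound
    BddAbove (Set.range fun u : Set.Icc (0 : Fin d → ℝ) τ => |Sectional.upper τ Z u|) ∧
    ∫ᵛ x in Set.Icc 0 τ, F x ∂•(Sectional.cubeMeasure τ Z) ≤
      Sectional.supNorm τ (Sectional.upper τ Z) *
        (Sectional.sectionalVariationNorm τ F).toReal := by
  have hF' : Sectional.HasBoundedSectionalVariation τ F := ⟨hF, hFv⟩
  have hZ' : Sectional.HasBoundedSectionalVariation τ Z := ⟨hZ, hZv⟩
  exact ⟨⟨_, hZ'.hasDistribution_cubeMeasure hτ,
      fun _ hν => hν.unique hτ (hZ'.hasDistribution_cubeMeasure hτ)⟩,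
    fun s hs => ⟨hF'.existsUnique_isGeneratedBy_sect hτ hs, hF'.variation_sectMeasure hτ hs⟩,
    hF'.integrableOn hτ _,
    fun s _ => Sectional.integrableOn_apply_Icc_zeroExtend τ s _ _,
    hF'.setIntegral_eq hτ _,
    Sectional.bddAbove_range_abs_upper τ Z,
    hF'.setIntegral_le hτ Z⟩
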